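/- Let $V$ be a finite-dimensional rational vector space with a non-singular symmetric bilinear form $B\colon V\times V\to\mathbb Q$, and let $L\subset V$ be an integral lattice, i.e. a finitely generated subgroup which spans $V$ over $\mathbb Q$ and satisfies $B(x,y)\in\mathbb Z$ for all $x,y\in L$. Put $L^{\#}=\{v\in V \mid B(v,\ell)\in\mathbb Z\ \text{for all } \ell\in L\}$. Then $L\subset L^{\#}$, the group $L^{\#}/L$ is finite, and $B$ induces a symmetric bilinear form $b_L\colon L^{\#}/L\times L^{\#}/L\to\mathbb Q/\mathbb Z$, $b_L([x],[y])=B(x,y) \bmod \mathbb Z$, which is non-singular (if $b_L(s,t)=0$ for all $t$, then $s=0$). Moreover $L$ has a characteristic element, i.e. an element $\nu\in L$ with $B(v,v)\equiv B(\nu,v) \pmod 2$ for all $v\in L$. For every characteristic element $\nu\in L$, the function $Q(x)=\frac{B(x,x)-B(\nu,x)}{2}$ on $L^{\#}$ induces a quadratic function $\psi_\nu\colon L^{\#}/L\to\mathbb Q/\mathbb Z$, $\psi_\nu([x])=Q(x) \bmod \mathbb Z$; that is, $\psi_\nu(at)=a^2\psi_\nu(t)$ for all $a\in\mathbb Z$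 and $\psi_\nu(s+t)-\psi_\nu(s)-\psi_\nu(t)$ is bilinear. It enhances $b_L$: $\psi_\nu(s+t)-\psi_\nu(s)-\psi_\nu(t)=b_L(s,t)$ for all $s,t$. The Gauss sum $G(\psi_\nu)=\sum_{t\in L^{\#}/L}e^{2\pi i\psi_\nu(t)}$ is non-zero, and its phase $\beta(\psi_\nu)\in\mathbb R/\mathbb Z$, defined by $G(\psi_\nu)=|G(\psi_\nu)|\,e^{2\pi i\beta(\psi_\nu)}$, is $$\beta(\psi_\nu)=\frac{\sigma(B)}{8}-\frac{B(\nu,\nu)}{8}\in\mathbb Q/\mathbb Z\subset\mathbb R/\mathbb Z,$$ where $\sigma(B)$ is the signature of $B$. -/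

import Mathlib

namespace GaussQuad

/-- `ℚ/ℤ`. -/
abbrev QModZ : Type := AddCircle (1 : ℚ)

/-- The inclusion `ℚ/ℤ → ℝ/ℤ`, sending the class of `q` to the class of `q`. -/
noncomputable def QModZ.toRModZ : QModZ →+ UnitAddCircle :=
  QuotientAddGroup.map (AddSubgroup.zmultiples (1 : ℚ)) (AddSubgroup.zmultiples (1 : ℝ))
    (Rat.castHom ℝ).toAddMonoidHom (by
      rw [AddSubgroup.zmultiples_le]
      simp)

theorem QModZ.toRModZ_coe (q : ℚ) :
    QModZ.toRModZ (q : QModZ) = ((q : ℝ) : UnitAddCircle) := rfl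

/-- The Gauss sum `G(ψ) = ∑ₜ exp(2πi ψ(t))` of a function `ψ : T → ℝ/ℤ` on a finite set `T`. -/
noncomputable def gaussSumOn {T : Type*} (ψ : T → UnitAddCircle) : ℂ :=
  ∑ᶠ t : T, ((AddCircle.toCircle (ψ t) : Circle) : ℂ)

/-- `β ∈ ℝ/ℤ` is the phase of `ψ`: the Gauss sum is nonzero (so that the phase is defined) and
`G(ψ) = |G(ψ)| · exp(2πi β)`. -/
def IsPhase {T : Type*} (ψ : T → UnitAddCircle) (β : UnitAddCircle) : Prop :=
  gaussSumOn ψ ≠ 0 ∧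
    gaussSumOn ψ = ((‖gaussSumOn ψ‖ : ℝ) : ℂ) * ((AddCircle.toCircle β : Circle) : ℂ)

/-- The phase is unique. -/
theorem IsPhase.unique {T : Type*} {ψ : T → UnitAddCircle} {β β' : UnitAddCircle}
    (h : IsPhase ψ β) (h' : IsPhase ψ β') : β = β' := by
  have hn : ((‖gaussSumOn ψ‖ : ℝ) : ℂ) ≠ 0 := by
    simpa using h.1
  have he := mul_left_cancel₀ hn (h.2.symm.trans h'.2)
  exact AddCircle.injective_toCircle one_ne_zero (Circle.ext he)

section Lattice

variable {V : Type*} [AddCommGroup V] [Module ℚ V]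

/-- `L` is integral for `B`: `B(x, y) ∈ ℤ` for all `x, y ∈ L`. -/
def IsIntegralLattice (B : LinearMap.BilinForm ℚ V) (L : Submodule ℤ V) : Prop :=
  ∀ x ∈ L, ∀ y ∈ L, ∃ n : ℤ, B x y = n

/-- The dual lattice `L^# = {v ∈ V | B(v, ℓ) ∈ ℤ for all ℓ ∈ L}`. -/
abbrev dual (B : LinearMap.BilinForm ℚ V) (L : Submodule ℤ V) : Submodule ℤ V :=
  B.dualSubmodule L

theorem mem_dual_iff (B : LinearMap.BilinForm ℚ V) (L : Submodule ℤ V) (v : V) :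
    v ∈ dual B L ↔ ∀ l ∈ L, ∃ n : ℤ, B v l = n := by
  simp [LinearMap.BilinForm.mem_dualSubmodule, Submodule.mem_one, eq_comm]

/-- The group `L^# / L` (used for integral `L`, where `L ⊆ L^#`). -/
abbrev DiscrGroup (B : LinearMap.BilinForm ℚ V) (L : Submodule ℤ V) : Type _ :=
  dual B L ⧸ L.submoduleOf (dual B L)

/-- The class in `L^# / L` of an element of `L^#`. -/
abbrev DiscrGroup.mk (B : LinearMap.BilinForm ℚ V) (L : Submodule ℤ V) (x : dual B L) :
    DiscrGroup B L :=
  Submodule.Quotient.mk x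

/-- `ν` is a characteristic element of `L`:
`ν ∈ L` and `B(v, v) ≡ B(ν, v) mod 2` for all `v ∈ L`. -/
def IsCharacteristic (B : LinearMap.BilinForm ℚ V) (L : Submodule ℤ V) (ν : V) : Prop :=
  ν ∈ L ∧ ∀ v ∈ L, ∃ k : ℤ, B v v - B ν v = 2 * k

/-- The signature `σ(B)` of a symmetric bilinear form: maximal dimension of a positive definite
subspace minus maximal dimension of a negative definite subspace. -/
noncomputable def signature (B : LinearMap.BilinForm ℚ V) : ℤ :=
  (sigPos (LinearMap.BilinMap.toQuadraticMap B) : ℤ) -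
    (sigNeg (LinearMap.BilinMap.toQuadraticMap B) : ℤ)

end Lattice

end GaussQuad

namespace GaussQuad
open Complex MeasureTheory Filter Topology

/-- The chirp `y ↦ exp(πi y²)`. -/
noncomputable def chirp (y : ℝ) : ℂ := exp (Real.pi * I * (y : ℂ) ^ 2)

theorem continuous_chirp : Continuous chirp := by unfold chirp; fun_prop

theorem norm_chirp (y : ℝ) : ‖chirp y‖ = 1 := by
  have : (Real.pi * I * (y : ℂ) ^ 2) = ((Real.pi * y ^ 2 : ℝ) : ℂ) * I := by push_cast; ring
  rw [chirp, this, norm_exp_ofReal_mul_I]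

theorem chirp_neg (y : ℝ) : chirp (-y) = chirp y := by simp [chirp]

theorem chirp_intervalIntegrable (A B : ℝ) : IntervalIntegrable chirp volume A B :=
  continuous_chirp.intervalIntegrable _ _

theorem hasDerivAt_chirp_div {y : ℝ} (hy : y ≠ 0) :
    HasDerivAt (fun y : ℝ => chirp y / (2 * Real.pi * I * y))
      (chirp y - chirp y / (2 * Real.pi * I * (y : ℂ) ^ 2)) y := by
  have hy' : (y : ℂ) ≠ 0 := by exact_mod_cast hy
  have hpi : (Real.pi : ℂ) ≠ 0 := by exact_mod_cast Real.pi_ne_zero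
  have h1 : HasDerivAt (fun z : ℂ => exp (Real.pi * I * z ^ 2) / (2 * Real.pi * I * z))
      (chirp y - chirp y / (2 * Real.pi * I * (y : ℂ) ^ 2)) (y : ℂ) := by
    have h2 : HasDerivAt (fun z : ℂ => exp (Real.pi * I * z ^ 2))
        (exp (Real.pi * I * (y : ℂ) ^ 2) * (Real.pi * I * (2 * y))) (y : ℂ) := by
      have := ((hasDerivAt_pow 2 (y : ℂ)).const_mul (Real.pi * I : ℂ)).cexp
      simpa using this
    have h3 : HasDerivAt (fun z : ℂ => (2 * Real.pi * I * z)) (2 * Real.pi * I) (y : ℂ) := by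
      simpa using (hasDerivAt_id (y : ℂ)).const_mul (2 * Real.pi * I : ℂ)
    refine (h2.div h3 (by simp [hpi, hy'])).congr_deriv ?_
    rw [chirp]
    field_simp
  exact h1.comp_ofReal

/-- Integration by parts for the Fresnel integral away from the origin. -/
theorem integral_chirp_sub_le {A B : ℝ} (hA : 0 < A) (hAB : A ≤ B) :
    ‖(∫ y in A..B, chirp y) -
      (chirp B / (2 * Real.pi * I * B) - chirp A / (2 * Real.pi * I * A))‖ ≤
      (1 / (2 * Real.pi)) * (1 / A - 1 / B) := by
  have hpos : ∀ y ∈ Set.uIcc A B, 0 < y := fun y hy => by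
    rw [Set.uIcc_of_le hAB] at hy; exact hA.trans_le hy.1
  have hpi : (Real.pi : ℂ) ≠ 0 := by exact_mod_cast Real.pi_ne_zero
  have hint : IntervalIntegrable (fun y : ℝ => chirp y / (2 * Real.pi * I * (y : ℂ) ^ 2))
      volume A B := by
    refine ContinuousOn.intervalIntegrable ?_
    refine continuous_chirp.continuousOn.div (by fun_prop) fun y hy => ?_
    have : (y : ℂ) ≠ 0 := by exact_mod_cast (hpos y hy).ne'
    simp [hpi, this]
  have h1 := intervalIntegral.integral_eq_sub_of_hasDerivAt
    (fun y hy => hasDerivAt_chirp_div (hpos y hy).ne') ((chirp_intervalIntegrable A B).sub hint)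
  rw [intervalIntegral.integral_sub (chirp_intervalIntegrable A B) hint] at h1
  rw [← h1, sub_sub_cancel]
  have hd : ∀ y ∈ Set.uIcc A B,
      HasDerivAt (fun y : ℝ => -(1 / (2 * Real.pi)) * y⁻¹) ((1 / (2 * Real.pi)) * (y ^ 2)⁻¹) y :=
    fun y hy => ((hasDerivAt_inv (hpos y hy).ne').const_mul (-(1 / (2 * Real.pi)))).congr_deriv
      (by ring)
  have hint2 : IntervalIntegrable (fun y : ℝ => (1 / (2 * Real.pi)) * (y ^ 2)⁻¹) volume A B := by
    refine ContinuousOn.intervalIntegrable ?_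
    refine continuousOn_const.mul (ContinuousOn.inv₀ (by fun_prop) fun y hy => ?_)
    exact pow_ne_zero _ (hpos y hy).ne'
  have h2 := intervalIntegral.integral_eq_sub_of_hasDerivAt hd hint2
  refine (intervalIntegral.norm_integral_le_of_norm_le hAB ?_ hint2).trans ?_
  · refine Eventually.of_forall fun y _ => ?_
    rw [norm_div, norm_chirp]
    simp [abs_of_pos Real.pi_pos, mul_comm]
  · rw [h2]
    apply le_of_eq
    ring

theorem norm_chirp_div {A : ℝ} (hA : 0 < A) :
    ‖chirp A / (2 * Real.pi * I * A)‖ = (1 / (2 * Real.pi)) * (1 / A) := by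
  rw [norm_div, norm_chirp]
  simp [abs_of_pos Real.pi_pos, abs_of_pos hA]
  ring

theorem norm_integral_chirp_le {A B : ℝ} (hA : 0 < A) (hAB : A ≤ B) :
    ‖∫ y in A..B, chirp y‖ ≤ 1 / A := by
  have h := integral_chirp_sub_le hA hAB
  have h1 := norm_chirp_div hA
  have h2 := norm_chirp_div (hA.trans_le hAB)
  have h3 := norm_le_norm_sub_add (∫ y in A..B, chirp y)
    (chirp B / (2 * Real.pi * I * B) - chirp A / (2 * Real.pi * I * A))
  have h4 := norm_sub_le (chirp B / (2 * Real.pi * I * B)) (chirp A / (2 * Real.pi * I * A))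
  have h5 : (1 / (2 * Real.pi)) * (1 / A) ≤ (1 / 2) * (1 / A) := by
    gcongr
    linarith [Real.pi_gt_three]
  linarith

theorem norm_integral_chirp_le_of_eq {A B : ℝ} (hA : 0 < A) (hAB : A ≤ B)
    (he : chirp A = chirp B) :
    ‖∫ y in A..B, chirp y‖ ≤ 1 / A - 1 / B := by
  have hB := hA.trans_le hAB
  have h := integral_chirp_sub_le hA hAB
  have h3 := norm_le_norm_sub_add (∫ y in A..B, chirp y)
    (chirp B / (2 * Real.pi * I * B) - chirp A / (2 * Real.pi * I * A))
  have h0 : 0 ≤ 1 / A - 1 / B := sub_nonneg.2 (one_div_le_one_div_of_le hA hAB)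
  have h4 : ‖chirp B / (2 * Real.pi * I * B) - chirp A / (2 * Real.pi * I * A)‖ =
      (1 / (2 * Real.pi)) * (1 / A - 1 / B) := by
    have : chirp B / (2 * Real.pi * I * B) - chirp A / (2 * Real.pi * I * A) =
        chirp A * (-1 / (2 * Real.pi * I)) * ((1 / A - 1 / B : ℝ) : ℂ) := by
      have hA' : (A : ℂ) ≠ 0 := by exact_mod_cast hA.ne'
      have hB' : (B : ℂ) ≠ 0 := by exact_mod_cast hB.ne'
      have hpi : (Real.pi : ℂ) ≠ 0 := by exact_mod_cast Real.pi_ne_zero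
      rw [he]; push_cast; field_simp; ring
    rw [this, norm_mul, norm_mul, norm_chirp, norm_real, Real.norm_of_nonneg h0]
    simp [abs_of_pos Real.pi_pos]
  have h5 : (1 / (2 * Real.pi)) * (1 / A - 1 / B) ≤ (1 / 2) * (1 / A - 1 / B) := by
    gcongr
    linarith [Real.pi_gt_three]
  linarith

/-- The integral of the chirp over the interval of length `s` centred at `s * n`. -/
noncomputable def chirpPiece (s : ℝ) (n : ℤ) : ℂ :=
  ∫ y in s * (n - 1 / 2)..s * (n + 1 / 2), chirp y

theorem chirpPiece_neg (s : ℝ) (n : ℤ) : chirpPiece s (-n) = chirpPiece s n := by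
  have h := intervalIntegral.integral_comp_neg (f := chirp)
    (a := s * (n - 1 / 2)) (b := s * (n + 1 / 2))
  simp_rw [chirp_neg] at h
  rw [chirpPiece, chirpPiece, h]
  congr 1 <;> push_cast <;> ring

theorem norm_chirpPiece_le {a : ℕ} (ha : 0 < a) {n : ℤ} (hn : n ≠ 0) :
    ‖chirpPiece (Real.sqrt a) n‖ ≤ 2 * (1 / (n : ℝ) ^ 2) := by
  wlog hpos : 0 < n generalizing n
  · have := this (n := -n) (by simpa) (by omega)
    simpa [chirpPiece_neg] using this
  have hn1 : (1 : ℝ) ≤ n := by exact_mod_cast hpos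
  have hs : (1 : ℝ) ≤ Real.sqrt a := Real.one_le_sqrt.2 (by exact_mod_cast ha)
  have hs2 : ((Real.sqrt a : ℝ) : ℂ) ^ 2 = a := by
    rw [← ofReal_pow, Real.sq_sqrt (Nat.cast_nonneg a)]; simp
  set s := Real.sqrt a
  have hA : 0 < s * (n - 1 / 2) := by apply mul_pos <;> linarith
  refine (norm_integral_chirp_le_of_eq hA (by gcongr; linarith) ?_).trans ?_
  · rw [chirp, chirp, exp_eq_exp_iff_exists_int]
    refine ⟨-(a * n), ?_⟩
    push_cast
    simp only [mul_pow, hs2]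
    ring
  · have h1 : 1 / (s * (n - 1 / 2)) - 1 / (s * (n + 1 / 2)) =
        (1 / s) * (1 / ((n : ℝ) ^ 2 - 1 / 4)) := by
      have : (n : ℝ) - 1 / 2 ≠ 0 := by linarith
      have : (n : ℝ) + 1 / 2 ≠ 0 := by linarith
      have : s ≠ 0 := by linarith
      have h : (n : ℝ) ^ 2 - 1 / 4 = (n - 1 / 2) * (n + 1 / 2) := by ring
      rw [h, div_sub_div _ _ (by positivity) (by positivity), ← one_div_mul_one_div]
      field_simp
      ring
    rw [h1]
    have h2 : 1 / s ≤ 1 := by rw [div_le_one] <;> linarith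
    have h3 : 1 / ((n : ℝ) ^ 2 - 1 / 4) ≤ 2 * (1 / (n : ℝ) ^ 2) := by
      rw [← mul_div_assoc, div_le_div_iff₀] <;> nlinarith
    have h4 : 0 ≤ 1 / ((n : ℝ) ^ 2 - 1 / 4) := by
      apply div_nonneg <;> nlinarith
    nlinarith

theorem summable_chirpPiece {a : ℕ} (ha : 0 < a) :
    Summable (chirpPiece (Real.sqrt a)) := by
  have h := (Real.summable_one_div_int_pow (p := 2)).2 (by norm_num)
  refine Summable.of_norm_bounded_eventually (h.mul_left 2) ?_
  rw [eventually_cofinite]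
  refine (Set.finite_singleton (0 : ℤ)).subset fun n hn => ?_
  by_contra h0
  exact hn (norm_chirpPiece_le ha h0)

theorem sum_chirpPiece (s : ℝ) (N : ℕ) :
    ∑ n ∈ Finset.Icc (-N : ℤ) N, chirpPiece s n =
      ∫ y in -(s * (N + 1 / 2))..s * (N + 1 / 2), chirp y := by
  induction N with
  | zero =>
    simp [chirpPiece]
  | succ N ih =>
    have hset : Finset.Icc (-((N + 1 : ℕ) : ℤ)) ((N + 1 : ℕ) : ℤ) =
        insert (-((N + 1 : ℕ) : ℤ)) (insert ((N + 1 : ℕ) : ℤ) (Finset.Icc (-N : ℤ) N)) := by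
      ext n; simp only [Finset.mem_insert, Finset.mem_Icc]; omega
    rw [hset, Finset.sum_insert (by simp; omega), Finset.sum_insert (by simp), ih]
    have e1 : chirpPiece s (-((N + 1 : ℕ) : ℤ)) =
        ∫ y in -(s * ((N + 1 : ℕ) + 1 / 2))..-(s * (N + 1 / 2)), chirp y := by
      rw [chirpPiece]; congr 1 <;> push_cast <;> ring
    have e2 : chirpPiece s ((N + 1 : ℕ) : ℤ) =
        ∫ y in s * (N + 1 / 2)..(s * ((N + 1 : ℕ) + 1 / 2)), chirp y := by
      rw [chirpPiece]; congr 1 <;> push_cast <;> ring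
    rw [e1, e2, add_comm (∫ y in s * (N + 1 / 2).._, chirp y), ← add_assoc,
      intervalIntegral.integral_add_adjacent_intervals,
      intervalIntegral.integral_add_adjacent_intervals] <;>
    exact chirp_intervalIntegrable _ _

theorem tendsto_integral_chirp {a : ℕ} {S : ℂ}
    (hS : HasSum (chirpPiece (Real.sqrt a)) S) :
    Tendsto (fun N : ℕ => ∫ y in -(Real.sqrt a * (N + 1 / 2))..Real.sqrt a * (N + 1 / 2), chirp y)
      atTop (𝓝 S) := by
  have h : Tendsto (fun N : ℕ => Finset.Icc (-N : ℤ) N) atTop atTop := by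
    refine tendsto_atTop_finset_of_monotone (fun a b h => ?_) fun n => ⟨n.natAbs, ?_⟩
    · exact Finset.Icc_subset_Icc (by simpa using h) (by simpa using h)
    · simp only [Finset.mem_Icc]; omega
  have := hS.comp h
  refine this.congr fun N => ?_
  exact sum_chirpPiece _ N

/-- Truncated Fresnel integrals for different scalings have the same limit. -/
theorem hasSum_chirpPiece_unique {a : ℕ} (ha : 0 < a) {S S' : ℂ}
    (hS : HasSum (chirpPiece (Real.sqrt a)) S) (hS' : HasSum (chirpPiece 1) S') : S = S' := by
  have h := tendsto_integral_chirp hS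
  have h' := tendsto_integral_chirp (a := 1) (S := S') (by simpa using hS')
  simp only [Nat.cast_one, Real.sqrt_one, one_mul] at h'
  have hs : (1 : ℝ) ≤ Real.sqrt a := Real.one_le_sqrt.2 (by exact_mod_cast ha)
  set s := Real.sqrt a
  refine sub_eq_zero.1 (tendsto_nhds_unique (h.sub h') ?_)
  have hlim : Tendsto (fun N : ℕ => 2 * (1 / ((N : ℝ) + 1 / 2))) atTop (𝓝 0) := by
    have : Tendsto (fun N : ℕ => ((N : ℝ) + 1 / 2)) atTop atTop :=
      tendsto_atTop_add_const_right _ _ tendsto_natCast_atTop_atTop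
    simpa using (this.inv_tendsto_atTop).const_mul 2
  refine squeeze_zero_norm (fun N => ?_) hlim
  have hR : (0 : ℝ) < N + 1 / 2 := by positivity
  have hle : (N : ℝ) + 1 / 2 ≤ s * (N + 1 / 2) := by nlinarith
  set R : ℝ := N + 1 / 2
  have hneg : (∫ y in -(s * R)..-R, chirp y) = ∫ y in R..s * R, chirp y := by
    rw [← intervalIntegral.integral_comp_neg]; simp_rw [chirp_neg]
  have e1 : (∫ y in -(s * R)..s * R, chirp y) - ∫ y in -R..R, chirp y =
      (∫ y in R..s * R, chirp y) + ∫ y in R..s * R, chirp y := by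
    nth_rw 2 [← hneg]
    rw [← intervalIntegral.integral_add_adjacent_intervals (chirp_intervalIntegrable (-(s * R)) (-R))
      (chirp_intervalIntegrable (-R) (s * R)),
      ← intervalIntegral.integral_add_adjacent_intervals (chirp_intervalIntegrable (-R) R)
      (chirp_intervalIntegrable R (s * R))]
    ring
  rw [e1, two_mul]
  exact (norm_add_le _ _).trans (add_le_add (norm_integral_chirp_le hR hle)
    (norm_integral_chirp_le hR hle))

end GaussQuad

namespace GaussQuad
open Complex MeasureTheory Filter Topology

/-- The summand of the one-dimensional Gauss sum, as a function of a real variable. -/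
noncomputable def gaussTerm (a : ℕ) (x : ℝ) : ℂ :=
  exp (Real.pi * I * ((x : ℂ) - a / 2) ^ 2 / a)

theorem continuous_gaussTerm (a : ℕ) : Continuous (gaussTerm a) := by
  unfold gaussTerm; fun_prop

theorem gaussTerm_eq_chirp {a : ℕ} (ha : 0 < a) (x : ℝ) (n : ℤ) :
    exp (2 * Real.pi * I * (-n : ℤ) * x) * gaussTerm a x =
      chirp (x / Real.sqrt a - Real.sqrt a * (n + 1 / 2)) := by
  have hs2 : ((Real.sqrt a : ℝ) : ℂ) ^ 2 = a := by
    rw [← ofReal_pow, Real.sq_sqrt (Nat.cast_nonneg a)]; simp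
  have ha' : (a : ℂ) ≠ 0 := by exact_mod_cast ha.ne'
  have hs0 : ((Real.sqrt a : ℝ) : ℂ) ≠ 0 := fun h => by rw [h] at hs2; simp at hs2; exact ha' hs2.symm
  obtain ⟨k, hk⟩ := Int.even_mul_succ_self n
  have hk' : (n : ℂ) ^ 2 + n = 2 * k := by
    have : (n : ℂ) * (n + 1) = k + k := by exact_mod_cast hk
    linear_combination this
  rw [gaussTerm, chirp, ← exp_add, exp_eq_exp_iff_exists_int]
  refine ⟨-(a * k), ?_⟩
  have : (((x / Real.sqrt a - Real.sqrt a * (n + 1 / 2) : ℝ)) : ℂ) ^ 2 =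
      (x : ℂ) ^ 2 / a - 2 * x * (n + 1 / 2) + a * (n + 1 / 2) ^ 2 := by
    rw [← hs2]; push_cast; field_simp; ring
  rw [this]
  push_cast
  field_simp
  linear_combination (-4 * a ^ 2 : ℂ) * hk'

theorem integral_gaussTerm {a : ℕ} (ha : 0 < a) (n : ℤ) :
    ∫ x in (0 : ℝ)..a, exp (2 * Real.pi * I * (-n : ℤ) * x) * gaussTerm a x =
      Real.sqrt a * chirpPiece (Real.sqrt a) n := by
  have hs0 : 0 < Real.sqrt a := Real.sqrt_pos.2 (by exact_mod_cast ha)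
  have hs2 : Real.sqrt a * Real.sqrt a = a := Real.mul_self_sqrt (Nat.cast_nonneg a)
  simp_rw [gaussTerm_eq_chirp ha]
  rw [intervalIntegral.integral_comp_div_sub chirp hs0.ne', ← chirpPiece_neg, chirpPiece,
    real_smul]
  congr 2
  · push_cast; ring
  · rw [div_eq_iff hs0.ne' |>.2 hs2.symm]
    push_cast; ring

theorem hasSum_chirpPiece_gaussTerm {a : ℕ} (ha : 0 < a) :
    HasSum (fun n => Real.sqrt a * chirpPiece (Real.sqrt a) n)
      (∑ k ∈ Finset.range a, gaussTerm a k) := by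
  have hend : gaussTerm a 0 = gaussTerm a a := by
    rw [gaussTerm, gaussTerm]; congr 1; push_cast; ring
  let F : ℝ → ℂ := fun t => ∑ k ∈ Finset.range a, gaussTerm a (t + k)
  have hFc : Continuous F := continuous_finsetSum _ fun k _ =>
    (continuous_gaussTerm a).comp (by fun_prop)
  have hF01 : F 0 = F (0 + 1) := by
    have h := Finset.sum_range_succ' (fun k : ℕ => gaussTerm a k) a
    rw [Finset.sum_range_succ] at h
    simp only [Nat.cast_zero, hend] at h
    have h' := add_right_cancel h
    simp only [F, zero_add]
    rw [h']
    exact Finset.sum_congr rfl fun k _ => by push_cast; rw [add_comm]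
  let G : C(UnitAddCircle, ℂ) :=
    ⟨AddCircle.liftIco 1 0 F, AddCircle.liftIco_continuous hF01 hFc.continuousOn⟩
  have hcoef : ∀ n : ℤ, fourierCoeff G n = Real.sqrt a * chirpPiece (Real.sqrt a) n := by
    intro n
    have h1 : fourierCoeff G n = _ := fourierCoeff_liftIco_eq (T := 1) (a := 0) F n
    rw [h1, fourierCoeffOn_eq_integral, ← integral_gaussTerm ha]
    have hi : ∀ A B : ℝ, IntervalIntegrable
        (fun x : ℝ => exp (2 * Real.pi * I * (-n : ℤ) * x) * gaussTerm a x) volume A B :=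
      fun A B => Continuous.intervalIntegrable
        (Continuous.mul (by fun_prop) (continuous_gaussTerm a)) _ _
    have h2 := intervalIntegral.sum_integral_adjacent_intervals (n := a) (a := fun k : ℕ => (k : ℝ))
      (fun k _ => hi k ((k + 1 : ℕ) : ℝ))
    simp only [Nat.cast_zero] at h2
    rw [← h2]
    have h3 : ∀ x : ℝ, fourier (-n) (x : AddCircle ((0 : ℝ) + 1 - 0)) • F x =
        ∑ k ∈ Finset.range a,
          exp (2 * Real.pi * I * (-n : ℤ) * ((x + k : ℝ) : ℂ)) * gaussTerm a (x + k) := by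
      intro x
      simp only [F, smul_eq_mul, Finset.mul_sum]
      refine Finset.sum_congr rfl fun k _ => ?_
      rw [fourier_coe_apply]
      congr 1
      rw [exp_eq_exp_iff_exists_int]
      refine ⟨n * k, ?_⟩
      push_cast
      ring
    simp_rw [h3]
    rw [intervalIntegral.integral_finsetSum]
    · simp only [zero_add, sub_zero, div_one, one_smul]
      refine Finset.sum_congr rfl fun k _ => ?_
      rw [intervalIntegral.integral_comp_add_right
        (fun x : ℝ => exp (2 * Real.pi * I * (-n : ℤ) * x) * gaussTerm a x)]
      congr 1 <;> push_cast <;> ring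
    · intro k _
      exact Continuous.intervalIntegrable
        (Continuous.mul (by fun_prop) ((continuous_gaussTerm a).comp (by fun_prop))) _ _
  have hs := has_pointwise_sum_fourier_series_of_summable (f := G)
    (((summable_chirpPiece ha).mul_left _).congr fun n => (hcoef n).symm) ((0 : ℝ) : UnitAddCircle)
  have hG0 : G ((0 : ℝ) : UnitAddCircle) = ∑ k ∈ Finset.range a, gaussTerm a k := by
    change AddCircle.liftIco 1 0 F ((0 : ℝ) : UnitAddCircle) = _
    rw [AddCircle.liftIco_coe_apply (by simp)]
    simp [F]
  rw [hG0] at hs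
  refine hs.congr_fun fun n => ?_
  rw [hcoef, fourier_coe_apply]
  simp

/-- The one-dimensional Gauss sum centred at `a / 2`. -/
theorem sum_gaussTerm {a : ℕ} (ha : 0 < a) :
    ∑ k ∈ Finset.range a, gaussTerm a k = Real.sqrt a * exp (Real.pi * I / 4) := by
  have hs0 : ((Real.sqrt a : ℝ) : ℂ) ≠ 0 := by
    exact_mod_cast (Real.sqrt_pos.2 (by exact_mod_cast ha : (0 : ℝ) < a)).ne'
  have h1 := hasSum_chirpPiece_gaussTerm one_pos
  have h := (hasSum_chirpPiece_gaussTerm ha).mul_left ((Real.sqrt a : ℝ) : ℂ)⁻¹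
  simp only [Nat.cast_one, Real.sqrt_one, ofReal_one, one_mul] at h1
  simp only [inv_mul_cancel_left₀ hs0] at h
  have := hasSum_chirpPiece_unique ha h h1
  rw [inv_mul_eq_iff_eq_mul₀ hs0] at this
  rw [this]
  simp only [Finset.range_one, Finset.sum_singleton, gaussTerm]
  congr 2
  push_cast
  ring

theorem sum_range_int_shift {a : ℕ} {h : ℤ → ℂ} (hp : Function.Periodic h a) (m : ℤ) :
    ∑ k ∈ Finset.range a, h (k + m) = ∑ k ∈ Finset.range a, h k := by
  have step : ∀ m : ℤ, ∑ k ∈ Finset.range a, h (k + (m + 1)) = ∑ k ∈ Finset.range a, h (k + m) := by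
    intro m
    have h1 := Finset.sum_range_succ' (fun k : ℕ => h (k + m)) a
    rw [Finset.sum_range_succ] at h1
    have h2 : h (a + m) = h ((0 : ℕ) + m) := by
      rw [add_comm, hp]; simp
    rw [h2] at h1
    rw [add_right_cancel h1]
    refine Finset.sum_congr rfl fun k _ => ?_
    congr 1; push_cast; ring
  induction m using Int.induction_on with
  | zero => simp
  | succ i ih => rw [step, ih]
  | pred i ih => rw [← ih, ← step]; simp

theorem sum_exp_pos {a : ℕ} (ha : 0 < a) {c : ℤ} (hc : (2 : ℤ) ∣ a - c) :
    ∑ k ∈ Finset.range a, exp (Real.pi * I * (((k : ℂ) ^ 2 - k * c) / a)) =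
      Real.sqrt a * exp (Real.pi * I * (1 / 4 - (c : ℂ) ^ 2 / (4 * a))) := by
  obtain ⟨m, hm⟩ := hc
  have ha' : (a : ℂ) ≠ 0 := by exact_mod_cast ha.ne'
  have hm' : (a : ℂ) - c = 2 * m := by exact_mod_cast hm
  have hc' : (c : ℂ) = a - 2 * m := by linear_combination -hm'
  have hp : Function.Periodic (fun k : ℤ => gaussTerm a k) a := by
    intro k
    simp only [gaussTerm]
    rw [exp_eq_exp_iff_exists_int]
    refine ⟨k, ?_⟩
    push_cast
    field_simp
    ring
  have h := sum_range_int_shift hp m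
  have h1 : ∑ k ∈ Finset.range a, gaussTerm a ((k : ℤ) : ℝ) =
      Real.sqrt a * exp (Real.pi * I / 4) := by
    rw [← sum_gaussTerm ha]; simp
  rw [h1] at h
  have h2 : Real.pi * I * (1 / 4 - (c : ℂ) ^ 2 / (4 * a)) =
      Real.pi * I / 4 + -(Real.pi * I * (c : ℂ) ^ 2 / (4 * a)) := by ring
  rw [h2, exp_add, ← mul_assoc, ← h, Finset.sum_mul]
  refine Finset.sum_congr rfl fun k _ => ?_
  rw [gaussTerm, ← exp_add]
  congr 1
  rw [hc']
  push_cast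
  field_simp
  ring

/-- The one-dimensional Gauss sum of the lattice `⟨a⟩` with characteristic element `c / a`. -/
theorem sum_exp_quadratic {a c : ℤ} (ha : a ≠ 0) (hc : 2 ∣ a - c) :
    ∑ k ∈ Finset.range a.natAbs, exp (Real.pi * I * (((k : ℂ) ^ 2 - k * c) / a)) =
      Real.sqrt a.natAbs * exp (Real.pi * I * (a.sign / 4 - (c : ℂ) ^ 2 / (4 * a))) := by
  rcases Int.natAbs_eq a with h | h
  · have hpos : 0 < a.natAbs := Int.natAbs_pos.2 ha
    have hs : a.sign = 1 := Int.sign_eq_one_of_pos (by omega)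
    have h0 := sum_exp_pos hpos (c := c) (by rwa [← h])
    have hcast : (a : ℂ) = (a.natAbs : ℂ) := by
      conv_lhs => rw [h]
      simp
    rw [hs, hcast, h0]
    simp
  · have hpos : 0 < a.natAbs := Int.natAbs_pos.2 ha
    have hs : a.sign = -1 := Int.sign_eq_neg_one_of_neg (by omega)
    have h0 := congrArg (starRingEnd ℂ) (sum_exp_pos hpos (c := c) (by omega))
    have hcast : (a : ℂ) = -(a.natAbs : ℂ) := by
      conv_lhs => rw [h]
      simp
    simp only [map_sum, map_mul, ← exp_conj, map_div₀, map_sub, map_pow, conj_ofReal, conj_I,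
      map_natCast, map_intCast, map_one, map_ofNat] at h0
    rw [hs, hcast]
    convert! h0 using 2
    · congr 1; rw [div_neg]; ring
    · congr 1; push_cast; rw [mul_neg, div_neg]; ring

end GaussQuad

namespace GaussQuad

theorem qModZ_coe_eq_zero_iff (q : ℚ) : (q : QModZ) = 0 ↔ ∃ n : ℤ, q = n := by
  rw [AddCircle.coe_eq_zero_iff]
  simp [eq_comm]

theorem qModZ_coe_eq_iff (p q : ℚ) : (p : QModZ) = q ↔ ∃ n : ℤ, p - q = n := by
  rw [← sub_eq_zero, ← AddCircle.coe_sub, qModZ_coe_eq_zero_iff]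

theorem exists_mulVec_eq_diag {ι : Type*} [Fintype ι] [DecidableEq ι]
    (A : Matrix ι ι (ZMod 2)) (hA : A.IsSymm) : ∃ x, A.mulVec x = A.diag := by
  by_contra hcon
  push Not at hcon
  have hd : A.diag ∉ LinearMap.range A.mulVecLin := by
    rintro ⟨x, hx⟩; exact hcon x hx
  obtain ⟨φ, hφ, hφ'⟩ := Submodule.exists_le_ker_of_notMem hd
  have hquad : ∀ y : ι → ZMod 2, y ⬝ᵥ A.mulVec y = A.diag ⬝ᵥ y := by
    let q : (ι → ZMod 2) →+ ZMod 2 :=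
      { toFun := fun y => y ⬝ᵥ A.mulVec y
        map_zero' := by simp
        map_add' := fun y z => by
          have : z ⬝ᵥ A.mulVec y = y ⬝ᵥ A.mulVec z := by
            rw [Matrix.dotProduct_mulVec, ← Matrix.mulVec_transpose, hA.eq, dotProduct_comm]
          rw [Matrix.mulVec_add, add_dotProduct, dotProduct_add, dotProduct_add, this]
          linear_combination (CharTwo.add_self_eq_zero (y ⬝ᵥ A.mulVec z)) }
    let l : (ι → ZMod 2) →+ ZMod 2 :=
      { toFun := fun y => A.diag ⬝ᵥ y
        map_zero' := by simp
        map_add' := fun y z => dotProduct_add _ _ _ }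
    have : q = l := by
      refine AddMonoidHom.functions_ext _ _ _ fun i c => ?_
      change (Pi.single i c) ⬝ᵥ A.mulVec (Pi.single i c) = A.diag ⬝ᵥ Pi.single i c
      have hc : c * c = c := by revert c; decide
      simp only [single_dotProduct, Matrix.mulVec_single, dotProduct_single, Matrix.diag]
      simp only [Pi.smul_apply, Matrix.col_apply, MulOpposite.smul_eq_mul_unop, MulOpposite.unop_op]
      rw [mul_comm, mul_assoc, hc]
    exact fun y => DFunLike.congr_fun this y
  have hφdot : ∀ z, φ z = (fun i => φ (Pi.single i 1)) ⬝ᵥ z := by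
    intro z
    rw [LinearMap.pi_apply_eq_sum_univ φ z]
    simp only [dotProduct, smul_eq_mul]
    refine Finset.sum_congr rfl fun i _ => ?_
    rw [mul_comm]
    congr 2
    ext j
    simp [Pi.single_apply, eq_comm]
  set y : ι → ZMod 2 := fun i => φ (Pi.single i 1)
  apply hφ
  rw [hφdot, dotProduct_comm, ← hquad, ← hφdot]
  exact hφ' ⟨y, rfl⟩

variable {V : Type*} [AddCommGroup V] [Module ℚ V] {B : LinearMap.BilinForm ℚ V}
  {L : Submodule ℤ V}

theorem IsIntegralLattice.le_dual (hint : IsIntegralLattice B L) : L ≤ dual B L :=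
  fun x hx => (mem_dual_iff B L x).2 fun y hy => hint x hx y hy

theorem exists_isCharacteristic (hsymm : B.IsSymm) (hL : L.IsLattice ℚ)
    (hint : IsIntegralLattice B L) : ∃ ν, IsCharacteristic B L ν := by
  let b := Module.Free.chooseBasis ℤ L
  let A : Matrix _ _ ℤ := fun i j => (hint (b i) (b i).2 (b j) (b j).2).choose
  have hA : ∀ i j, B (b i) (b j) = A i j := fun i j => (hint (b i) (b i).2 (b j) (b j).2).choose_spec
  have hAs : ∀ i j, A i j = A j i := fun i j => by
    have : (A i j : ℚ) = A j i := by rw [← hA, ← hA]; exact hsymm.eq _ _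
    exact_mod_cast this
  obtain ⟨x, hx⟩ := exists_mulVec_eq_diag (A.map (Int.cast : ℤ → ZMod 2))
    (by ext i j; simp [hAs i j])
  let v : L := ∑ j, ((x j).val : ℤ) • b j
  refine ⟨v, v.2, fun w hw => ?_⟩
  have hBν : ∀ i, B v (b i) = ((∑ j, ((x j).val : ℤ) * A j i : ℤ) : ℚ) := by
    intro i
    simp only [v, Submodule.coe_sum, Submodule.coe_smul, map_sum, LinearMap.sum_apply]
    push_cast
    refine Finset.sum_congr rfl fun j _ => ?_
    rw [← hA]
    simp
  have hspan : (⟨w, hw⟩ : L) ∈ Submodule.span ℤ (Set.range b) := by rw [b.span_eq]; trivial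
  suffices ∀ u ∈ Submodule.span ℤ (Set.range b), ∃ k : ℤ,
      B (u : V) u - B v u = 2 * k from this _ hspan
  intro u hu
  induction hu using Submodule.span_induction with
  | mem u hu =>
    obtain ⟨i, rfl⟩ := hu
    have h2 : ((A i i - ∑ j, ((x j).val : ℤ) * A j i : ℤ) : ZMod 2) = 0 := by
      have := congrFun hx i
      simp only [Matrix.mulVec, dotProduct, Matrix.map_apply, Matrix.diag] at this
      push_cast
      rw [← this, sub_eq_zero]
      refine Finset.sum_congr rfl fun j _ => ?_
      rw [hAs i j, ZMod.natCast_zmod_val, mul_comm]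
    obtain ⟨k, hk⟩ := (ZMod.intCast_zmod_eq_zero_iff_dvd _ 2).1 h2
    refine ⟨k, ?_⟩
    rw [hA, hBν]
    exact_mod_cast hk
  | zero => exact ⟨0, by simp⟩
  | add u u' _ _ ih ih' =>
    obtain ⟨k, hk⟩ := ih
    obtain ⟨k', hk'⟩ := ih'
    obtain ⟨m, hm⟩ := hint u u.2 u' u'.2
    refine ⟨k + k' + m, ?_⟩
    have hs : B (u' : V) u = B (u : V) u' := hsymm.eq _ _
    simp only [Submodule.coe_add, map_add, LinearMap.add_apply, hs, hm]
    push_cast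
    linear_combination hk + hk'
  | smul n u _ ih =>
    obtain ⟨k, hk⟩ := ih
    obtain ⟨m, hm⟩ := hint v v.2 u u.2
    obtain ⟨j, hj⟩ := Int.even_mul_pred_self n
    refine ⟨n ^ 2 * k + j * m, ?_⟩
    have hj' : (n : ℚ) * (n - 1) = j + j := by exact_mod_cast hj
    simp only [Submodule.coe_smul, map_zsmul, LinearMap.smul_apply, zsmul_eq_mul]
    push_cast
    rw [hm] at hk ⊢
    linear_combination (n : ℚ) ^ 2 * hk + m * hj'

theorem exists_basis_span_eq (hL : L.IsLattice ℚ) :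
    ∃ b : Module.Basis (Module.Free.ChooseBasisIndex ℤ L) ℚ V,
      Submodule.span ℤ (Set.range b) = L := by
  let b := (Module.Free.chooseBasis ℤ L).extendOfIsLattice ℚ
  have h2 := congrArg (Submodule.map L.subtype) (Module.Free.chooseBasis ℤ L).span_eq
  rw [Submodule.map_span, Submodule.map_top, Submodule.range_subtype, ← Set.range_comp] at h2
  refine ⟨b, Eq.trans ?_ h2⟩
  congr 2
  ext i
  simp [b]

theorem dual_fg [FiniteDimensional ℚ V] (hB : B.Nondegenerate) (hL : L.IsLattice ℚ) :
    (dual B L).FG := by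
  classical
  obtain ⟨b, hb⟩ := exists_basis_span_eq hL
  rw [← hb, dual, LinearMap.BilinForm.dualSubmodule_span_of_basis B hB]
  exact Submodule.fg_span (Set.finite_range _)

theorem dual_dual [FiniteDimensional ℚ V] (hsymm : B.IsSymm) (hB : B.Nondegenerate)
    (hL : L.IsLattice ℚ) : dual B (dual B L) = L := by
  obtain ⟨b, hb⟩ := exists_basis_span_eq hL
  have h := LinearMap.BilinForm.dualSubmodule_dualSubmodule_of_basis (R := ℤ) B hB hsymm b
  rwa [hb] at h

theorem exists_zsmul_mem (hL : L.IsLattice ℚ) (x : V) : ∃ n : ℤ, n ≠ 0 ∧ n • x ∈ L := by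
  have hx : x ∈ Submodule.span ℚ (L : Set V) := by rw [hL.span_eq_top]; trivial
  induction hx using Submodule.span_induction with
  | mem x hx => exact ⟨1, one_ne_zero, by simpa using hx⟩
  | zero => exact ⟨1, one_ne_zero, by simp⟩
  | add x y _ _ hx hy =>
    obtain ⟨n, hn, hx⟩ := hx
    obtain ⟨m, hm, hy⟩ := hy
    refine ⟨n * m, mul_ne_zero hn hm, ?_⟩
    have : (n * m) • (x + y) = m • n • x + n • m • y := by module
    rw [this]
    exact L.add_mem (L.smul_mem _ hx) (L.smul_mem _ hy)
  | smul q x _ hx =>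
    obtain ⟨n, hn, hx⟩ := hx
    refine ⟨q.den * n, mul_ne_zero (by exact_mod_cast q.den_ne_zero) hn, ?_⟩
    have : ((q.den : ℤ) * n) • q • x = q.num • n • x := by
      have h : (q.den : ℚ) * q = q.num := Rat.den_mul_eq_num q
      simp only [← Int.cast_smul_eq_zsmul ℚ, smul_smul]
      congr 1
      push_cast
      linear_combination (n : ℚ) * h
    rw [this]
    exact L.smul_mem _ hx

theorem finite_discrGroup [FiniteDimensional ℚ V] (hB : B.Nondegenerate) (hL : L.IsLattice ℚ) :
    Finite (DiscrGroup B L) := by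
  have : Module.Finite ℤ (dual B L) := Module.Finite.iff_fg.2 (dual_fg hB hL)
  refine Module.finite_of_fg_torsion _ fun t => ?_
  obtain ⟨x, rfl⟩ := Submodule.Quotient.mk_surjective _ t
  obtain ⟨n, hn, hx⟩ := exists_zsmul_mem hL (x : V)
  refine ⟨⟨n, mem_nonZeroDivisors_of_ne_zero hn⟩, ?_⟩
  change n • DiscrGroup.mk B L x = _
  rw [← Submodule.Quotient.mk_smul, Submodule.Quotient.mk_eq_zero]
  exact hx

theorem discrGroup_mk_eq_iff (x y : dual B L) :
    DiscrGroup.mk B L x = DiscrGroup.mk B L y ↔ (x : V) - y ∈ L := by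
  rw [Submodule.Quotient.eq]; rfl

/-- The pairing `L^# × L^# → ℚ/ℤ`. -/
noncomputable def dualPairing (B : LinearMap.BilinForm ℚ V) (L : Submodule ℤ V) :
    LinearMap.BilinMap ℤ (dual B L) QModZ :=
  LinearMap.mk₂ ℤ (fun x y => ((B x y : ℚ) : QModZ))
    (fun x y z => by simp) (fun n x y => by rw [← AddCircle.coe_zsmul]; congr 1; simp)
    (fun x y z => by simp) (fun n x y => by rw [← AddCircle.coe_zsmul]; congr 1; simp)

theorem dualPairing_apply (x y : dual B L) :
    dualPairing B L x y = ((B x y : ℚ) : QModZ) := rfl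

/-- The discriminant form `b_L` on `L^# / L`. -/
noncomputable def discrForm (hsymm : B.IsSymm) : LinearMap.BilinMap ℤ (DiscrGroup B L) QModZ :=
  (dualPairing B L).liftQ₂ (L.submoduleOf (dual B L)) (L.submoduleOf (dual B L))
    (fun x hx => by
      ext y
      simp only [dualPairing_apply, LinearMap.zero_apply]
      obtain ⟨n, hn⟩ := (mem_dual_iff B L y).1 y.2 x hx
      rw [qModZ_coe_eq_zero_iff]
      exact ⟨n, by rw [← hn]; exact hsymm.eq _ _⟩)
    (fun x hx => by
      ext y
      simp only [LinearMap.flip_apply, dualPairing_apply, LinearMap.zero_apply]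
      rw [qModZ_coe_eq_zero_iff]
      exact (mem_dual_iff B L y).1 y.2 x hx)

theorem discrForm_mk (hsymm : B.IsSymm) (x y : dual B L) :
    discrForm hsymm (DiscrGroup.mk B L x) (DiscrGroup.mk B L y) = ((B x y : ℚ) : QModZ) := rfl

theorem discrForm_symm (hsymm : B.IsSymm) (s t : DiscrGroup B L) :
    discrForm hsymm s t = discrForm hsymm t s := by
  obtain ⟨x, rfl⟩ := Submodule.Quotient.mk_surjective _ s
  obtain ⟨y, rfl⟩ := Submodule.Quotient.mk_surjective _ t
  rw [discrForm_mk, discrForm_mk, show B x y = B y x from hsymm.eq _ _]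

theorem discrForm_nondegenerate [FiniteDimensional ℚ V] (hsymm : B.IsSymm)
    (hB : B.Nondegenerate) (hL : L.IsLattice ℚ) :
    (discrForm (L := L) hsymm).Nondegenerate := by
  have key : ∀ s : DiscrGroup B L, (∀ t, discrForm hsymm s t = 0) → s = 0 := by
    intro s hs
    obtain ⟨x, rfl⟩ := Submodule.Quotient.mk_surjective _ s
    rw [Submodule.Quotient.mk_eq_zero]
    change (x : V) ∈ L
    refine (dual_dual hsymm hB hL).le ((mem_dual_iff _ _ _).2 fun y hy => ?_)
    rw [← qModZ_coe_eq_zero_iff]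
    exact (discrForm_mk hsymm x ⟨y, hy⟩).symm.trans (hs _)
  exact ⟨key, fun t ht => key t fun s => (discrForm_symm hsymm t s).trans (ht s)⟩

/-- The rational number `(B(x, x) - B(ν, x)) / 2`. -/
def enhancement (B : LinearMap.BilinForm ℚ V) (ν x : V) : ℚ := (B x x - B ν x) / 2

theorem enhancement_add (hsymm : B.IsSymm) (ν x y : V) :
    enhancement B ν (x + y) = enhancement B ν x + enhancement B ν y + B x y := by
  have hs : B y x = B x y := hsymm.eq _ _
  simp only [enhancement, map_add, LinearMap.add_apply, hs]
  ring

theorem enhancement_coe_eq (hsymm : B.IsSymm) {ν : V}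
    (hν : ∀ v ∈ L, ∃ k : ℤ, B v v - B ν v = 2 * k) (x y : dual B L)
    (h : (x : V) - y ∈ L) :
    ((enhancement B ν x : ℚ) : QModZ) = (enhancement B ν y : ℚ) := by
  obtain ⟨k, hk⟩ := hν _ h
  obtain ⟨m, hm⟩ := (mem_dual_iff B L y).1 y.2 _ h
  rw [qModZ_coe_eq_iff]
  refine ⟨k + m, ?_⟩
  have := enhancement_add hsymm ν (y : V) (x - y)
  rw [add_sub_cancel] at this
  have h2 : enhancement B ν ((x : V) - y) = k := by rw [enhancement, hk]; ring
  rw [this, hm, h2]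
  push_cast
  ring

/-- The function `ψ_ν` on `L^# / L`, as a bare function. -/
noncomputable def discrFun (hsymm : B.IsSymm) {ν : V}
    (hν : ∀ v ∈ L, ∃ k : ℤ, B v v - B ν v = 2 * k) (t : DiscrGroup B L) : QModZ :=
  Quotient.lift (s := Submodule.quotientRel _)
    (fun x : dual B L => ((enhancement B ν x : ℚ) : QModZ))
    (fun x y h => enhancement_coe_eq hsymm hν x y
      ((discrGroup_mk_eq_iff x y).1 (Quotient.sound h))) t

theorem discrFun_mk (hsymm : B.IsSymm) {ν : V}
    (hν : ∀ v ∈ L, ∃ k : ℤ, B v v - B ν v = 2 * k) (x : dual B L) :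
    discrFun hsymm hν (DiscrGroup.mk B L x) = ((enhancement B ν x : ℚ) : QModZ) := rfl

theorem discrFun_add (hsymm : B.IsSymm) {ν : V}
    (hν : ∀ v ∈ L, ∃ k : ℤ, B v v - B ν v = 2 * k) (s t : DiscrGroup B L) :
    discrFun hsymm hν (s + t) =
      discrFun hsymm hν s + discrFun hsymm hν t + discrForm hsymm s t := by
  obtain ⟨x, rfl⟩ := Submodule.Quotient.mk_surjective _ s
  obtain ⟨y, rfl⟩ := Submodule.Quotient.mk_surjective _ t
  rw [← Submodule.Quotient.mk_add, discrFun_mk, discrFun_mk, discrFun_mk, discrForm_mk,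
    Submodule.coe_add, enhancement_add hsymm]
  simp

/-- The quadratic enhancement `ψ_ν` of the discriminant form. -/
noncomputable def discrQuadratic (hsymm : B.IsSymm) {ν : V} (hν : IsCharacteristic B L ν) :
    QuadraticMap ℤ (DiscrGroup B L) QModZ where
  toFun := discrFun hsymm hν.2
  toFun_smul a t := by
    obtain ⟨x, rfl⟩ := Submodule.Quotient.mk_surjective _ t
    obtain ⟨m, hm⟩ := (mem_dual_iff B L x).1 x.2 _ hν.1
    have hm' : B ν x = m := by rw [← hm]; exact hsymm.eq _ _
    obtain ⟨j, hj⟩ := Int.even_mul_pred_self a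
    have hj' : (a : ℚ) * (a - 1) = j + j := by exact_mod_cast hj
    rw [← Submodule.Quotient.mk_smul, discrFun_mk, discrFun_mk, ← AddCircle.coe_zsmul,
      qModZ_coe_eq_iff]
    refine ⟨j * m, ?_⟩
    simp only [enhancement, Submodule.coe_smul, map_zsmul, LinearMap.smul_apply, zsmul_eq_mul, hm']
    push_cast
    linear_combination (m / 2 : ℚ) * hj'
  exists_companion' := ⟨discrForm hsymm, discrFun_add hsymm hν.2⟩

end GaussQuad

namespace GaussQuad
open Complex

/-- The additive character `q ↦ exp(2πi q)` of `ℚ/ℤ`. -/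
noncomputable def qChar : AddChar QModZ ℂ where
  toFun q := ((AddCircle.toCircle (QModZ.toRModZ q) : Circle) : ℂ)
  map_zero_eq_one' := by simp
  map_add_eq_mul' x y := by simp [AddCircle.toCircle_add]

theorem qChar_coe (q : ℚ) : qChar (q : QModZ) = exp (2 * Real.pi * I * q) := by
  change ((AddCircle.toCircle (QModZ.toRModZ (q : QModZ)) : Circle) : ℂ) = _
  rw [QModZ.toRModZ_coe, AddCircle.toCircle_apply_mk, Circle.coe_exp]
  congr 1
  push_cast
  ring

theorem norm_qChar (q : QModZ) : ‖qChar q‖ = 1 := Circle.norm_coe _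

theorem qChar_eq_one_iff (q : QModZ) : qChar q = 1 ↔ q = 0 := by
  refine ⟨fun h => ?_, fun h => by rw [h, AddChar.map_zero_eq_one]⟩
  induction q using QuotientAddGroup.induction_on with | _ q
  have h' : qChar (q : QModZ) = 1 := h
  rw [qChar_coe, exp_eq_one_iff] at h'
  obtain ⟨n, hn⟩ := h'
  refine (qModZ_coe_eq_zero_iff q).2 ⟨n, ?_⟩
  have h2 : (2 * Real.pi * I : ℂ) ≠ 0 := two_pi_I_ne_zero
  have h3 : (q : ℂ) = n := mul_left_cancel₀ h2 (by rw [hn]; ring)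
  exact_mod_cast h3

theorem sum_comp_addMonoidHom {G H : Type*} [AddCommGroup G] [AddCommGroup H] [Fintype G]
    [Fintype H] (p : G →+ H) (hp : Function.Surjective p) (g : H → ℂ) :
    ∃ r : ℝ, 0 < r ∧ ∑ d, g (p d) = r * ∑ t, g t := by
  classical
  refine ⟨(Finset.univ.filter fun d => p d = 0).card, ?_, ?_⟩
  · exact_mod_cast Finset.card_pos.2 ⟨0, by simp⟩
  · rw [← Finset.sum_fiberwise Finset.univ p, Finset.mul_sum]
    refine Finset.sum_congr rfl fun t _ => ?_
    rw [Finset.sum_congr rfl (g := fun _ => g t)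
      (fun d hd => by rw [(Finset.mem_filter.1 hd).2]), Finset.sum_const, nsmul_eq_mul,
      AddMonoidHom.card_fiber_eq_of_mem_range p (hp t) (hp 0)]
    simp

variable {V : Type*} [AddCommGroup V] [Module ℚ V] {B : LinearMap.BilinForm ℚ V}
  {L L' : Submodule ℤ V}

theorem dual_anti (hle : L' ≤ L) : dual B L ≤ dual B L' :=
  fun _ hx y hy => hx y (hle hy)

/-- Passing to a sublattice of finite index multiplies the Gauss sum by a positive factor. -/
theorem exists_gaussSum_sublattice (hsymm : B.IsSymm) (hint : IsIntegralLattice B L)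
    (hle : L' ≤ L) {ν : V} (hν : ∀ v ∈ L, ∃ k : ℤ, B v v - B ν v = 2 * k)
    [Fintype (DiscrGroup B L)] [Fintype (DiscrGroup B L')] :
    ∃ r : ℝ, 0 < r ∧
      ∑ t, qChar (discrFun hsymm (fun v hv => hν v (hle hv)) t : QModZ) =
        r * ∑ t : DiscrGroup B L, qChar (discrFun hsymm hν t) := by
  classical
  have hν' : ∀ v ∈ L', ∃ k : ℤ, B v v - B ν v = 2 * k := fun v hv => hν v (hle hv)
  have hLd : L ≤ dual B L' := hint.le_dual.trans (dual_anti hle)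
  let H : Submodule ℤ (DiscrGroup B L') :=
    (L.submoduleOf (dual B L')).map (L'.submoduleOf (dual B L')).mkQ
  let i : (dual B L ⧸ L'.submoduleOf (dual B L)) →ₗ[ℤ] DiscrGroup B L' :=
    Submodule.mapQ _ _ (Submodule.inclusion (dual_anti hle)) fun x hx => hx
  let p : (dual B L ⧸ L'.submoduleOf (dual B L)) →ₗ[ℤ] DiscrGroup B L :=
    Submodule.mapQ _ _ LinearMap.id fun x hx => hle hx
  have hi : Function.Injective i := by
    rw [injective_iff_map_eq_zero]
    intro d hd
    obtain ⟨x, rfl⟩ := Submodule.Quotient.mk_surjective _ d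
    have hd := (Submodule.Quotient.mk_eq_zero _).1 hd
    rw [Submodule.Quotient.mk_eq_zero]
    exact hd
  have hp : Function.Surjective p := by
    intro t
    obtain ⟨x, rfl⟩ := Submodule.Quotient.mk_surjective _ t
    exact ⟨Submodule.Quotient.mk x, rfl⟩
  have : Finite (dual B L ⧸ L'.submoduleOf (dual B L)) := Finite.of_injective i hi
  have := Fintype.ofFinite (dual B L ⧸ L'.submoduleOf (dual B L))
  obtain ⟨r, hr, hsum⟩ := sum_comp_addMonoidHom p.toAddMonoidHom hp
    fun t => qChar (discrFun hsymm hν t)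
  refine ⟨r, hr, ?_⟩
  rw [← hsum]
  set q : DiscrGroup B L' → ℂ := fun t => qChar (discrFun hsymm hν' t) with hq
  let χ : DiscrGroup B L' → AddChar H ℂ := fun t =>
    qChar.compAddMonoidHom ((discrForm hsymm t).toAddMonoidHom.comp H.subtype.toAddMonoidHom)
  have hχ : ∀ t (h : H), χ t h = qChar (discrForm hsymm t h) := fun _ _ => rfl
  have hH0 : ∀ h : H, discrFun hsymm hν' (h : DiscrGroup B L') = 0 := by
    rintro ⟨h, x, hx, rfl⟩
    change discrFun hsymm hν' (DiscrGroup.mk B L' x) = 0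
    rw [discrFun_mk, qModZ_coe_eq_zero_iff]
    obtain ⟨k, hk⟩ := hν x hx
    exact ⟨k, by rw [enhancement, hk]; ring⟩
  have hshift : ∀ t (h : H), q (t + h) = q t * χ t h := by
    intro t h
    rw [hq, hχ]
    simp only
    rw [discrFun_add, hH0, add_zero, AddChar.map_add_eq_mul]
  have hrange : ∀ t, χ t = 0 ↔ ∃ d, i d = t := by
    intro t
    constructor
    · intro ht
      obtain ⟨x, rfl⟩ := Submodule.Quotient.mk_surjective _ t
      refine ⟨Submodule.Quotient.mk ⟨x, (mem_dual_iff _ _ _).2 fun l hl => ?_⟩, rfl⟩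
      have := DFunLike.congr_fun ht ⟨DiscrGroup.mk B L' ⟨l, hLd hl⟩, ⟨l, hLd hl⟩, hl, rfl⟩
      rw [hχ, AddChar.zero_apply, qChar_eq_one_iff] at this
      exact (qModZ_coe_eq_zero_iff _).1 ((discrForm_mk hsymm x ⟨l, hLd hl⟩).symm.trans this)
    · rintro ⟨d, rfl⟩
      obtain ⟨x, rfl⟩ := Submodule.Quotient.mk_surjective _ d
      ext ⟨h, y, hy, rfl⟩
      rw [hχ, AddChar.zero_apply, qChar_eq_one_iff]
      refine (discrForm_mk hsymm _ y).trans ((qModZ_coe_eq_zero_iff _).2 ?_)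
      exact (mem_dual_iff _ _ _).1 x.2 y hy
  have hcard : (Fintype.card H : ℂ) ≠ 0 := Nat.cast_ne_zero.2 Fintype.card_ne_zero
  have hmain : (Fintype.card H : ℂ) * ∑ t, q t =
      (Fintype.card H : ℂ) * ∑ d, q (i d) := by
    calc (Fintype.card H : ℂ) * ∑ t, q t = ∑ h : H, ∑ t, q (t + h) := by
          have h1 : ∀ h : H, ∑ t, q (t + h) = ∑ t, q t := fun h =>
            Fintype.sum_equiv (Equiv.addRight (h : DiscrGroup B L')) (fun t => q (t + h)) q
              (fun t => rfl)
          simp [h1]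
      _ = ∑ t, q t * ∑ h : H, χ t h := by
          rw [Finset.sum_comm]
          refine Finset.sum_congr rfl fun t _ => ?_
          rw [Finset.mul_sum]
          exact Finset.sum_congr rfl fun h _ => hshift t h
      _ = ∑ t ∈ Finset.univ.filter (fun t => ∃ d, i d = t), q t * Fintype.card H := by
          rw [Finset.sum_filter]
          refine Finset.sum_congr rfl fun t _ => ?_
          rw [AddChar.sum_eq_ite, ← if_congr (hrange t) rfl rfl]
          split_ifs <;> simp
      _ = _ := by
          rw [← Finset.sum_mul, mul_comm]
          congr 1
          symm
          refine Finset.sum_nbij i (fun d _ => by simp) hi.injOn (fun t ht => ?_) fun _ _ => rfl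
          simpa using ht
  have h1 := mul_left_cancel₀ hcard hmain
  refine h1.trans (Finset.sum_congr rfl fun d _ => ?_)
  obtain ⟨x, rfl⟩ := Submodule.Quotient.mk_surjective _ d
  rfl

theorem mem_dual_span_iff {ι : Type*} (e : ι → V) (x : V) :
    x ∈ dual B (Submodule.span ℤ (Set.range e)) ↔ ∀ i, ∃ n : ℤ, B x (e i) = n := by
  rw [mem_dual_iff]
  refine ⟨fun h i => h _ (Submodule.subset_span ⟨i, rfl⟩), fun h y hy => ?_⟩
  induction hy using Submodule.span_induction with
  | mem y hy => obtain ⟨i, rfl⟩ := hy; exact h i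
  | zero => exact ⟨0, by simp⟩
  | add y z _ _ hy hz =>
    obtain ⟨n, hn⟩ := hy
    obtain ⟨m, hm⟩ := hz
    exact ⟨n + m, by simp [hn, hm]⟩
  | smul k y _ hy =>
    obtain ⟨n, hn⟩ := hy
    exact ⟨k * n, by simp [hn]⟩

section Orthogonal

variable {ι : Type*} [Fintype ι] (e : Module.Basis ι ℚ V) {a : ι → ℤ}

theorem bilin_basis_right (ho : B.IsOrthoᵢ e) (ha : ∀ i, B (e i) (e i) = a i) (x : V) (i : ι) :
    B x (e i) = e.repr x i * a i := by
  conv_lhs => rw [← e.sum_repr x]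
  rw [map_sum, LinearMap.sum_apply, Finset.sum_eq_single i]
  · simp [ha]
  · intro j _ hj
    rw [map_smul, LinearMap.smul_apply, show B (e j) (e i) = 0 from ho hj, smul_zero]
  · simp

theorem mem_span_basis_iff (ho : B.IsOrthoᵢ e) (ha : ∀ i, B (e i) (e i) = a i)
    (ha0 : ∀ i, a i ≠ 0) (x : V) :
    x ∈ Submodule.span ℤ (Set.range e) ↔ ∀ i, ∃ n : ℤ, B x (e i) = n * a i := by
  rw [e.mem_span_iff_repr_mem ℤ]
  refine forall_congr' fun i => ?_
  rw [bilin_basis_right e ho ha]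
  have : (a i : ℚ) ≠ 0 := by exact_mod_cast ha0 i
  simp [this, eq_comm]

theorem isLattice_span_basis : (Submodule.span ℤ (Set.range e)).IsLattice ℚ :=
  ⟨Submodule.fg_span (Set.finite_range _), by
    rw [eq_top_iff, ← e.span_eq]
    exact Submodule.span_mono Submodule.subset_span⟩

/-- The vector of the dual of an orthogonal lattice which pairs to `k i` with `e i`. -/
noncomputable def dualVector (a : ι → ℤ) (k : ι → ℕ) : V := ∑ i, ((k i : ℚ) / a i) • e i

theorem bilin_dualVector (ho : B.IsOrthoᵢ e) (ha : ∀ i, B (e i) (e i) = a i)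
    (ha0 : ∀ i, a i ≠ 0) (k : ι → ℕ) (i : ι) : B (dualVector e a k) (e i) = k i := by
  have : (a i : ℚ) ≠ 0 := by exact_mod_cast ha0 i
  rw [bilin_basis_right e ho ha, dualVector, e.repr_sum_self]
  field_simp

theorem enhancement_dualVector (ho : B.IsOrthoᵢ e) (ha : ∀ i, B (e i) (e i) = a i)
    (ha0 : ∀ i, a i ≠ 0) {ν : V} {c : ι → ℤ} (hc : ∀ i, B ν (e i) = c i) (k : ι → ℕ) :
    enhancement B ν (dualVector e a k) =
      ∑ i, (((k i : ℚ) ^ 2 - k i * c i) / a i) / 2 := by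
  have h1 : ∀ y, B y (dualVector e a k) = ∑ i, ((k i : ℚ) / a i) * B y (e i) := by
    intro y; simp [dualVector]
  rw [enhancement, h1, h1, ← Finset.sum_sub_distrib, Finset.sum_div]
  refine Finset.sum_congr rfl fun i _ => ?_
  rw [bilin_dualVector e ho ha ha0, hc]
  ring

theorem bilin_self_eq_sum (ho : B.IsOrthoᵢ e) (ha : ∀ i, B (e i) (e i) = a i)
    (ha0 : ∀ i, a i ≠ 0) {ν : V} {c : ι → ℤ} (hc : ∀ i, B ν (e i) = c i) :
    B ν ν = ∑ i, (c i : ℚ) ^ 2 / a i := by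
  conv_lhs => rw [← e.sum_repr ν, map_sum, e.sum_repr ν]
  refine Finset.sum_congr rfl fun i _ => ?_
  have h := bilin_basis_right e ho ha ν i
  have : (a i : ℚ) ≠ 0 := by exact_mod_cast ha0 i
  rw [hc] at h
  rw [map_smul, hc, smul_eq_mul, h]
  field_simp

/-- The Gauss sum of an orthogonal lattice is a product of one-dimensional Gauss sums. -/
theorem gaussSum_orthogonal (hsymm : B.IsSymm) (ho : B.IsOrthoᵢ e)
    (ha : ∀ i, B (e i) (e i) = a i) (ha0 : ∀ i, a i ≠ 0) {ν : V} {c : ι → ℤ}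
    (hc : ∀ i, B ν (e i) = c i)
    (hν : ∀ v ∈ Submodule.span ℤ (Set.range e), ∃ k : ℤ, B v v - B ν v = 2 * k)
    [Fintype (DiscrGroup B (Submodule.span ℤ (Set.range e)))] :
    ∑ t, qChar (discrFun hsymm hν t) =
      ∏ i, ∑ k ∈ Finset.range (a i).natAbs,
        exp (Real.pi * I * (((k : ℂ) ^ 2 - k * c i) / a i)) := by
  classical
  rw [Finset.prod_univ_sum]
  have hmem : ∀ k, dualVector e a k ∈ dual B (Submodule.span ℤ (Set.range e)) := fun k =>
    (mem_dual_span_iff e _).2 fun i => ⟨k i, by simp [bilin_dualVector e ho ha ha0]⟩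
  symm
  refine Finset.sum_nbij (fun k => DiscrGroup.mk B _ ⟨dualVector e a k, hmem k⟩)
    (fun _ _ => Finset.mem_univ _) ?_ ?_ ?_
  · intro k hk k' hk' h
    rw [discrGroup_mk_eq_iff, mem_span_basis_iff e ho ha ha0] at h
    simp only [Finset.mem_coe, Fintype.mem_piFinset, Finset.mem_range] at hk hk'
    ext i
    obtain ⟨n, hn⟩ := h i
    rw [map_sub, LinearMap.sub_apply, bilin_dualVector e ho ha ha0,
      bilin_dualVector e ho ha ha0] at hn
    have hn' : (k i : ℤ) - k' i = a i * n := by rw [mul_comm]; exact_mod_cast hn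
    have hdvd : ((a i).natAbs : ℤ) ∣ (k i : ℤ) - k' i := Int.natAbs_dvd.2 ⟨n, hn'⟩
    have := Int.eq_zero_of_abs_lt_dvd hdvd (by
      have := hk i; have := hk' i; rw [abs_lt]; omega)
    omega
  · intro t _
    obtain ⟨x, rfl⟩ := Submodule.Quotient.mk_surjective _ t
    choose m hm using (mem_dual_span_iff e _).1 x.2
    refine ⟨fun i => (m i % (a i).natAbs).toNat, ?_, ?_⟩
    · simp only [Finset.mem_coe, Fintype.mem_piFinset, Finset.mem_range]
      intro i
      have h0 : ((a i).natAbs : ℤ) ≠ 0 := by simpa using ha0 i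
      have := Int.emod_lt_of_pos (m i) (b := (a i).natAbs) (by have := ha0 i; omega)
      have := Int.emod_nonneg (m i) h0
      omega
    · rw [discrGroup_mk_eq_iff, mem_span_basis_iff e ho ha ha0]
      intro i
      rw [map_sub, LinearMap.sub_apply, bilin_dualVector e ho ha ha0, hm]
      have h0 : ((a i).natAbs : ℤ) ≠ 0 := by simpa using ha0 i
      have hnn := Int.emod_nonneg (m i) h0
      have hdvd : a i ∣ (m i % (a i).natAbs) - m i := by
        rw [← Int.natAbs_dvd]
        exact Int.dvd_emod_sub_self
      obtain ⟨n, hn⟩ := hdvd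
      refine ⟨n, ?_⟩
      have : (((m i % (a i).natAbs).toNat : ℤ)) - m i = n * a i := by
        rw [Int.toNat_of_nonneg hnn, hn, mul_comm]
      exact_mod_cast this
  · intro k _
    rw [discrFun_mk, qChar_coe, enhancement_dualVector e ho ha ha0 hc, ← exp_sum]
    congr 1
    push_cast
    rw [Finset.mul_sum]
    refine Finset.sum_congr rfl fun i _ => ?_
    ring

theorem signature_eq_sum_sign [FiniteDimensional ℚ V] (hsymm : B.IsSymm) (ho : B.IsOrthoᵢ e)
    (ha : ∀ i, B (e i) (e i) = a i) : signature B = ∑ i, (a i).sign := by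
  have heq : (LinearMap.BilinMap.toQuadraticMap B).Equivalent
      (QuadraticMap.weightedSumSquares ℚ fun i => (a i : ℚ)) := by
    have h := QuadraticMap.basisRepr_eq_of_iIsOrtho (LinearMap.BilinMap.toQuadraticMap B) e
      (by rw [QuadraticMap.associated_left_inverse ℚ hsymm.eq]; exact ho)
    have h2 : (fun i => LinearMap.BilinMap.toQuadraticMap B (e i)) = fun i => (a i : ℚ) :=
      funext ha
    rw [h2] at h
    rw [← h]
    exact ⟨QuadraticMap.isometryEquivBasisRepr _ e⟩
  rw [signature, QuadraticForm.sigPos_of_equiv_weightedSumSquares heq,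
    QuadraticForm.sigNeg_of_equiv_weightedSumSquares heq]
  have hsign : ∀ i, (a i).sign = (if 0 < a i then 1 else 0) - (if a i < 0 then 1 else 0) := by
    intro i
    rcases lt_trichotomy (a i) 0 with h | h | h
    · simp [Int.sign_eq_neg_one_of_neg h, h, h.not_gt]
    · simp [h]
    · simp [Int.sign_eq_one_of_pos h, h, h.not_gt]
  simp only [hsign, Finset.sum_sub_distrib, Finset.sum_boole, Int.cast_pos, Int.cast_lt_zero]
  simp [Set.ncard_eq_toFinset_card']

end Orthogonal

end GaussQuad

namespace GaussQuad
open Complex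

variable {V : Type*} [AddCommGroup V] [Module ℚ V] {B : LinearMap.BilinForm ℚ V}
  {L : Submodule ℤ V}

/-- An integral lattice contains a lattice spanned by an orthogonal basis of `V`. -/
theorem exists_orthogonal_basis_mem [FiniteDimensional ℚ V] (hsymm : B.IsSymm)
    (hB : B.Nondegenerate) (hL : L.IsLattice ℚ) (hint : IsIntegralLattice B L) :
    ∃ (e : Module.Basis (Fin (Module.finrank ℚ V)) ℚ V) (a : Fin (Module.finrank ℚ V) → ℤ),
      B.IsOrthoᵢ e ∧ (∀ i, B (e i) (e i) = a i) ∧ (∀ i, a i ≠ 0) ∧ ∀ i, e i ∈ L := by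
  obtain ⟨v, hv⟩ := LinearMap.BilinForm.exists_orthogonal_basis (B := B) ⟨hsymm.eq⟩
  choose n hn hmem using fun i => exists_zsmul_mem hL (v i)
  have hu : ∀ i, IsUnit (n i : ℚ) := fun i => by
    rw [isUnit_iff_ne_zero]; exact_mod_cast hn i
  let e := v.isUnitSMul hu
  have he : ∀ i, e i = n i • v i := fun i => by
    rw [Module.Basis.isUnitSMul_apply, Int.cast_smul_eq_zsmul]
  have hmem' : ∀ i, e i ∈ L := fun i => by rw [he]; exact hmem i
  have ho : B.IsOrthoᵢ e := fun i j hij => by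
    have : B (v i) (v j) = 0 := hv hij
    change B (e i) (e j) = 0
    rw [he, he]
    simp [this]
  choose a ha using fun i => hint _ (hmem' i) _ (hmem' i)
  refine ⟨e, a, ho, ha, fun i h0 => ?_, hmem'⟩
  have := ho.not_isOrtho_basis_self_of_separatingLeft hB.1 i
  exact this ((ha i).trans (by simp [h0]))

/-- The generalised Milgram formula, up to a positive factor. -/
theorem exists_gaussSum_eq [FiniteDimensional ℚ V] (hsymm : B.IsSymm) (hB : B.Nondegenerate)
    (hL : L.IsLattice ℚ) (hint : IsIntegralLattice B L) {ν : V} (hν : IsCharacteristic B L ν)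
    [Fintype (DiscrGroup B L)] :
    ∃ r : ℝ, 0 < r ∧ ∑ t, qChar (discrFun hsymm hν.2 t) =
      r * qChar (((signature B : ℚ) / 8 - B ν ν / 8 : ℚ) : QModZ) := by
  obtain ⟨e, a, ho, ha, ha0, hmem⟩ := exists_orthogonal_basis_mem hsymm hB hL hint
  have hle : Submodule.span ℤ (Set.range e) ≤ L :=
    Submodule.span_le.2 (by rintro _ ⟨i, rfl⟩; exact hmem i)
  have := finite_discrGroup hB (isLattice_span_basis e)
  have := Fintype.ofFinite (DiscrGroup B (Submodule.span ℤ (Set.range e)))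
  choose c hc using fun i => hint ν hν.1 (e i) (hmem i)
  have hac : ∀ i, 2 ∣ a i - c i := fun i => by
    obtain ⟨k, hk⟩ := hν.2 _ (hmem i)
    rw [ha, hc] at hk
    exact ⟨k, by exact_mod_cast hk⟩
  obtain ⟨r, hr, hsum⟩ := exists_gaussSum_sublattice hsymm hint hle hν.2
  rw [gaussSum_orthogonal e hsymm ho ha ha0 hc,
    Finset.prod_congr rfl fun i _ => sum_exp_quadratic (ha0 i) (hac i), Finset.prod_mul_distrib,
    ← exp_sum] at hsum
  have hpos : 0 < ∏ i, Real.sqrt (a i).natAbs := Finset.prod_pos fun i _ =>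
    Real.sqrt_pos.2 (by exact_mod_cast Int.natAbs_pos.2 (ha0 i))
  have hr' : (r : ℂ) ≠ 0 := by exact_mod_cast hr.ne'
  refine ⟨(∏ i, Real.sqrt (a i).natAbs) / r, div_pos hpos hr, ?_⟩
  rw [← mul_right_inj' hr', ← hsum, qChar_coe, signature_eq_sum_sign e hsymm ho ha,
    bilin_self_eq_sum e ho ha ha0 hc]
  push_cast
  rw [← mul_assoc, mul_div_cancel₀ _ hr']
  congr 2
  rw [← Finset.mul_sum, Finset.sum_sub_distrib, ← Finset.sum_div,
    show ∑ i, (c i : ℂ) ^ 2 / (4 * a i) = (∑ i, (c i : ℂ) ^ 2 / a i) / 4 by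
      rw [Finset.sum_div]; exact Finset.sum_congr rfl fun i _ => by rw [div_div, mul_comm]]
  ring

theorem isPhase_discrQuadratic [FiniteDimensional ℚ V] (hsymm : B.IsSymm) (hB : B.Nondegenerate)
    (hL : L.IsLattice ℚ) (hint : IsIntegralLattice B L) {ν : V} (hν : IsCharacteristic B L ν) :
    IsPhase (fun t => QModZ.toRModZ (discrQuadratic hsymm hν t))
      (QModZ.toRModZ (((signature B : ℚ) / 8 - B ν ν / 8 : ℚ) : QModZ)) := by
  have := finite_discrGroup hB hL
  have := Fintype.ofFinite (DiscrGroup B L)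
  obtain ⟨r, hr, hsum⟩ := exists_gaussSum_eq hsymm hB hL hint hν
  have hG : gaussSumOn (fun t => QModZ.toRModZ (discrQuadratic hsymm hν t)) =
      r * qChar (((signature B : ℚ) / 8 - B ν ν / 8 : ℚ) : QModZ) := by
    rw [gaussSumOn, finsum_eq_sum_of_fintype]
    exact hsum
  have hnorm : ‖gaussSumOn (fun t => QModZ.toRModZ (discrQuadratic hsymm hν t))‖ = r := by
    rw [hG, norm_mul, norm_qChar, mul_one, norm_real, Real.norm_of_nonneg hr.le]
  refine ⟨norm_ne_zero_iff.1 (hnorm ▸ hr.ne'), ?_⟩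
  rw [hnorm, hG]
  rfl

end GaussQuad

open GaussQuad in
/-- Quadratic functions `T → ℚ/ℤ` are Mathlib's `QuadraticMap ℤ T (ℚ/ℤ)`: maps with
`ψ(a x) = a² ψ(x)` for `a ∈ ℤ` such that `ψ(x + y) - ψ(x) - ψ(y)` is bilinear. -/
theorem theorem2p2 {V : Type*} [AddCommGroup V] [Module ℚ V] [FiniteDimensional ℚ V]
    (B : LinearMap.BilinForm ℚ V) (hsymm : B.IsSymm) (hB : B.Nondegenerate)
    (L : Submodule ℤ V) (hL : L.IsLattice ℚ) (hint : IsIntegralLattice B L) :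
    L ≤ dual B L ∧ Finite (DiscrGroup B L) ∧
    (∃ b : LinearMap.BilinMap ℤ (DiscrGroup B L) QModZ,
      (∀ x y : dual B L,
        b (DiscrGroup.mk B L x) (DiscrGroup.mk B L y) = ((B x y : ℚ) : QModZ)) ∧
      (∀ s t, b s t = b t s) ∧ b.Nondegenerate ∧
      (∃ ν, IsCharacteristic B L ν) ∧
      ∀ ν, IsCharacteristic B L ν →
        ∃ ψ : QuadraticMap ℤ (DiscrGroup B L) QModZ,
          (∀ x : dual B L,
            ψ (DiscrGroup.mk B L x) = (((B x x - B ν x) / 2 : ℚ) : QModZ)) ∧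
          (∀ s t, ψ (s + t) - ψ s - ψ t = b s t) ∧
          IsPhase (fun t => QModZ.toRModZ (ψ t))
            (QModZ.toRModZ (((signature B : ℚ) / 8 - B ν ν / 8 : ℚ) : QModZ))) := by
  refine ⟨hint.le_dual, finite_discrGroup hB hL, discrForm hsymm, discrForm_mk hsymm,
    discrForm_symm hsymm, discrForm_nondegenerate hsymm hB hL,
    exists_isCharacteristic hsymm hL hint, fun ν hν => ⟨discrQuadratic hsymm hν,
    discrFun_mk hsymm hν.2, fun s t => ?_, isPhase_discrQuadratic hsymm hB hL hint hν⟩⟩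
  rw [sub_sub, sub_eq_iff_eq_add']
  exact discrFun_add hsymm hν.2 s t
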